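/- Let $F$ be a field and let $A$ be a finite-dimensional unital (not necessarily associative) $F$-algebra. Write $(x,y,z)=(xy)z-x(yz)$. The nucleus $\mathrm{Nuc}(A)$ is the set of $x\in A$ with $(x,a,b)=(a,x,b)=(a,b,x)=0$ for all $a,b\in A$; it is an associative $F$-subalgebra of $A$. The center of $A$ is the set of elements of $\mathrm{Nuc}(A)$ commuting with every element of $A$, and $A$ is $F$-central if $c\mapsto c\cdot 1$ is an isomorphism from $F$ onto the center. A module over a ring is minimally faithful if it is faithful and no proper section of it (a quotient $N/N'$ of submodules $N'\subseteq N$, other than the module itself) is faithful. The algebra $A$ is semiassociative if it is $F$-central and there is a commutative étale $F$-subalgebra $K\subseteq \mathrm{Nuc}(A)$ (containing $1$) such that $A$ is minimally faithful as a module over $K\otimes_F K$ via $(k\otimes k')a=kak'$. Put $\sigma(A)=\mathrm{Nuc}(A)/\mathrm{Jac}(\mathrm{Nuc}(A))$, where $\mathrm{Jac}$ is the Jacobson radical. Let $A$ be a semiassociative $F$-algebra. Then $\sigma(A)$ is a separable $F$-algebra, i.e. it is projective as a module over $\sigma(A)\otimes_F\sigma(A)^{\mathrm{op}}$. Moreover,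 there is an injective $F$-algebra homomorphism $s\colon\sigma(A)\to\mathrm{Nuc}(A)$ which is a section of the quotient map $\mathrm{Nuc}(A)\to\sigma(A)$, and $$\mathrm{Nuc}(A)=s(\sigma(A))\oplus \mathrm{Jac}(\mathrm{Nuc}(A))$$ as $F$-vector spaces. -/

import Mathlib

open scoped TensorProduct

section Nucleus

/-- The nucleus of a unital nonassociative ring: the elements whose associators
`(x, a, b)`, `(a, x, b)`, `(a, b, x)` all vanish. -/
def nucleus (A : Type*) [NonAssocRing A] : Subring A where
  carrier := {x | (∀ a b : A, associator x a b = 0) ∧ (∀ a b : A, associator a x b = 0) ∧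
    (∀ a b : A, associator a b x = 0)}
  mul_mem' := by
    rintro x y ⟨hx1, hx2, hx3⟩ ⟨hy1, hy2, hy3⟩
    simp only [associator_apply, sub_eq_zero] at *
    refine ⟨fun a b => ?_, fun a b => ?_, fun a b => ?_⟩
    · rw [hx1, hx1, hx1, hy1]
    · rw [← hx2, hy2, hx2, hx1]
    · rw [← hy3, hx3, hy3, hy3]
  one_mem' := by simp [associator_apply]
  add_mem' := by
    rintro x y ⟨hx1, hx2, hx3⟩ ⟨hy1, hy2, hy3⟩
    simp only [Set.mem_ofPred_eq, associator_apply, sub_eq_zero] at *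
    simp [add_mul, mul_add, hx1, hx2, hx3, hy1, hy2, hy3]
  zero_mem' := by simp [associator_apply]
  neg_mem' := by
    rintro x ⟨hx1, hx2, hx3⟩
    simp only [Set.mem_ofPred_eq, associator_apply, sub_eq_zero] at *
    simp [hx1, hx2, hx3]

namespace nucleus

theorem left_assoc {A : Type*} [NonAssocRing A] (x : nucleus A) (a b : A) :
    (x : A) * a * b = x * (a * b) := sub_eq_zero.1 (x.2.1 a b)

theorem mid_assoc {A : Type*} [NonAssocRing A] (x : nucleus A) (a b : A) :
    a * (x : A) * b = a * (x * b) := sub_eq_zero.1 (x.2.2.1 a b)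

theorem right_assoc {A : Type*} [NonAssocRing A] (x : nucleus A) (a b : A) :
    a * b * (x : A) = a * (b * x) := sub_eq_zero.1 (x.2.2.2 a b)

/-- The nucleus is an associative ring. -/
instance instRing (A : Type*) [NonAssocRing A] : Ring (nucleus A) where
  __ := SubringClass.toNonAssocRing (nucleus A)
  mul_assoc x y z := Subtype.ext (left_assoc x y z)

instance instSMul (F A : Type*) [Field F] [NonAssocRing A] [Module F A] [IsScalarTower F A A]
    [SMulCommClass F A A] : SMul F (nucleus A) where
  smul c x := ⟨c • (x : A), by
    refine ⟨fun a b => ?_, fun a b => ?_, fun a b => ?_⟩ <;>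
    simp [associator_apply, smul_mul_assoc, mul_smul_comm, left_assoc, mid_assoc,
      right_assoc]⟩

instance instModule (F A : Type*) [Field F] [NonAssocRing A] [Module F A] [IsScalarTower F A A]
    [SMulCommClass F A A] : Module F (nucleus A) :=
  Function.Injective.module F (nucleus A).toAddSubgroup.subtype Subtype.val_injective
    (fun _ _ => rfl)

/-- The nucleus of a nonassociative `F`-algebra is an associative `F`-algebra. -/
instance instAlgebra (F A : Type*) [Field F] [NonAssocRing A] [Module F A] [IsScalarTower F A A]
    [SMulCommClass F A A] : Algebra F (nucleus A) :=
  Algebra.ofModule (fun c x y => Subtype.ext (smul_mul_assoc c (x : A) (y : A)))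
    (fun c x y => Subtype.ext (mul_smul_comm c (x : A) (y : A)))

end nucleus

/-- The semisimple quotient `Nuc(A) / Jac(Nuc(A))` of the nucleus. -/
abbrev semisimpleQuotient (A : Type*) [NonAssocRing A] : Type _ :=
  nucleus A ⧸ Ring.jacobson (nucleus A)

end Nucleus

section Semiassociative

/-- A module is minimally faithful if it is faithful and no proper section
(a quotient `N / N'` of submodules `N' ≤ N`, other than `M / 0` itself) is faithful. -/
def IsMinimallyFaithful (R M : Type*) [Ring R] [AddCommGroup M] [Module R M] : Prop :=
  FaithfulSMul R M ∧ ∀ N' N : Submodule R M, N' ≤ N →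
    FaithfulSMul R (N ⧸ N'.submoduleOf N) → N' = ⊥ ∧ N = ⊤

/-- The algebra `A` is `F`-central: the structure map `c ↦ c • 1` is injective with image the
center of `A` (the elements of the nucleus commuting with all of `A`). -/
def IsCentralNonAssoc (F A : Type*) [Field F] [NonAssocRing A] [Module F A] : Prop :=
  Function.Injective (fun c : F => c • (1 : A)) ∧
    Set.range (fun c : F => c • (1 : A)) = Set.center A

open scoped IsMulCommutative

/-- Left multiplication of a subalgebra of the nucleus on `A`. -/
def nucLeft (F A : Type*) [Field F] [NonAssocRing A] [Module F A] [IsScalarTower F A A]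
    [SMulCommClass F A A] (K : Subalgebra F (nucleus A)) : K →ₐ[F] Module.End F A :=
  AlgHom.ofLinearMap
    { toFun := fun k => LinearMap.mulLeft F ((k : nucleus A) : A)
      map_add' := fun x y => LinearMap.ext fun a => add_mul (x.1 : A) (y.1 : A) a
      map_smul' := fun c x => LinearMap.ext fun a => smul_mul_assoc c (x.1 : A) a }
    (LinearMap.ext fun a => one_mul a)
    (fun x y => LinearMap.ext fun a => nucleus.left_assoc x.1 (y.1 : A) a)

/-- Right multiplication of a commutative subalgebra of the nucleus on `A`. -/
def nucRight (F A : Type*) [Field F] [NonAssocRing A] [Module F A] [IsScalarTower F A A]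
    [SMulCommClass F A A] (K : Subalgebra F (nucleus A)) [IsMulCommutative K] :
    K →ₐ[F] Module.End F A :=
  AlgHom.ofLinearMap
    { toFun := fun k => LinearMap.mulRight F ((k : nucleus A) : A)
      map_add' := fun x y => LinearMap.ext fun a => mul_add a (x.1 : A) (y.1 : A)
      map_smul' := fun c x => LinearMap.ext fun a => mul_smul_comm c a (x.1 : A) }
    (LinearMap.ext fun a => mul_one a)
    (fun x y => LinearMap.ext fun a => by
      rw [mul_comm x y]
      exact (nucleus.right_assoc x.1 a (y.1 : A)).symm)

/-- The action `(k ⊗ k') a = k a k'` of `K ⊗ K` on `A`, for a commutative subalgebra `K` of the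
nucleus. -/
def nucBiact (F A : Type*) [Field F] [NonAssocRing A] [Module F A] [IsScalarTower F A A]
    [SMulCommClass F A A] (K : Subalgebra F (nucleus A)) [IsMulCommutative K] :
    K ⊗[F] K →ₐ[F] Module.End F A :=
  Algebra.TensorProduct.lift (nucLeft F A K) (nucRight F A K) (fun x y =>
    LinearMap.ext fun a => (nucleus.left_assoc x.1 a (y.1 : A)).symm)

theorem nucBiact_tmul (F A : Type*) [Field F] [NonAssocRing A] [Module F A] [IsScalarTower F A A]
    [SMulCommClass F A A] (K : Subalgebra F (nucleus A)) [IsMulCommutative K] (k k' : K) (a : A) :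
    nucBiact F A K (k ⊗ₜ k') a = ((k : nucleus A) : A) * a * ((k' : nucleus A) : A) :=
  nucleus.left_assoc k.1 a (k'.1 : A) ▸ rfl

/-- `A` is minimally faithful as a module over `K ⊗ K`. -/
def IsMinimallyFaithfulOver (F A : Type*) [Field F] [NonAssocRing A] [Module F A]
    [IsScalarTower F A A] [SMulCommClass F A A] (K : Subalgebra F (nucleus A))
    [IsMulCommutative K] : Prop :=
  letI : Module (K ⊗[F] K) A := Module.compHom A (nucBiact F A K).toRingHom
  IsMinimallyFaithful (K ⊗[F] K) A

/-- A finite dimensional central nonassociative `F`-algebra is semiassociative if it is minimally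
faithful over `K ⊗ K` for some étale `F`-subalgebra `K` of its nucleus. -/
def IsSemiassociative (F A : Type*) [Field F] [NonAssocRing A] [Module F A]
    [IsScalarTower F A A] [SMulCommClass F A A] : Prop :=
  FiniteDimensional F A ∧ IsCentralNonAssoc F A ∧
    ∃ (K : Subalgebra F (nucleus A)) (_ : IsMulCommutative K),
      Algebra.Etale F K ∧ IsMinimallyFaithfulOver F A K

end Semiassociative

section Separable

/-- An associative `F`-algebra `R` is separable if it is projective as a module over
`R ⊗ Rᵐᵒᵖ`, acting by `(r ⊗ r') x = r x r'`. -/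
def IsSeparableAlgebra (F R : Type*) [Field F] [Ring R] [Algebra F R] : Prop :=
  letI : Module (R ⊗[F] Rᵐᵒᵖ) R := TensorProduct.Algebra.module
  Module.Projective (R ⊗[F] Rᵐᵒᵖ) R

end Separable

/-!
Since `K ⊗ K` is a finite product of fields, minimal faithfulness makes `A` free of rank one over
it, so the nucleus `N` is isomorphic to a sub-bimodule of `K ⊗ K`. The Jacobson radical `J` is
therefore the image of an element `g` of `K ⊗ K`, and `R = N / J` is again a sub-bimodule of
`K ⊗ K`. Hence `K` is its own centralizer in `R`, so the center `Z` of `R` lies in `K` and is étale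
over `F`. By the density theorem, `R` is an Azumaya algebra over `Z`, hence separable over `F`.

Lift `Z` to `K ⊆ N`. As `g` kills `R`, on which the tensor product of `R` and `Rᵐᵒᵖ` over `Z` acts
faithfully, the image of `g` in the tensor square of `K` over `Z` vanishes, so `g` kills the
centralizer of `Z` in `N`. Conversely, if `g` kills `x` then it kills the commutators of `x` with
`Z`; these lie in `J`, where `g` acts as the identity, so they vanish. Thus the kernel of `g`, which
is a complement of `J`, is the centralizer of `Z` and in particular a subalgebra.
-/

section Unramified

theorem exists_mem_forall_mul_eq_self {T : Type*} [CommRing T] [IsSemisimpleRing T] (I : Ideal T) :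
    ∃ g ∈ I, ∀ x ∈ I, g * x = x := by
  obtain ⟨p, hp⟩ := IsSemisimpleModule.extension_property I.subtype I.subtype_injective
    LinearMap.id
  refine ⟨p 1, (p 1).2, fun x hx ↦ ?_⟩
  calc (p 1 : T) * x = (x • p 1 : I) := mul_comm _ _
    _ = p x := by rw [← p.map_smul, smul_eq_mul, mul_one]
    _ = x := congrArg Subtype.val (LinearMap.congr_fun hp ⟨x, hx⟩)

variable (F : Type*) [Field F]

theorem isSemisimpleRing_of_formallyUnramified (T : Type*) [CommRing T] [Algebra F T]
    [Algebra.FormallyUnramified F T] [Module.Finite F T] : IsSemisimpleRing T := by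
  have : IsArtinianRing T := IsArtinianRing.of_finite F T
  have := Algebra.FormallyUnramified.isReduced_of_field F T
  exact IsArtinianRing.isSemisimpleRing_of_isReduced T

theorem isSemisimpleRing_tensorProduct (K : Type*) [CommRing K] [Algebra F K]
    [Algebra.FormallyUnramified F K] [Module.Finite F K] : IsSemisimpleRing (K ⊗[F] K) := by
  have : Algebra.FormallyUnramified F (K ⊗[F] K) := Algebra.FormallyUnramified.comp F K (K ⊗[F] K)
  exact isSemisimpleRing_of_formallyUnramified F (K ⊗[F] K)

variable {F} {T K : Type*} [CommRing T] [Algebra F T] [CommRing K] [Algebra F K]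

theorem formallyUnramified_of_injective [Module.Finite F K] [Algebra.FormallyUnramified F K]
    {f : T →ₐ[F] K} (hf : Function.Injective f) : Algebra.FormallyUnramified F T := by
  have : Module.Finite F T := Module.Finite.of_injective f.toLinearMap hf
  have := isSemisimpleRing_tensorProduct F K
  have : IsReduced (T ⊗[F] T) := isReduced_of_injective (Algebra.TensorProduct.map f f)
    (TensorProduct.map_injective_of_flat_flat _ _ hf hf)
  have : IsArtinianRing (T ⊗[F] T) := IsArtinianRing.of_finite F _
  have : IsSemisimpleRing (T ⊗[F] T) := IsArtinianRing.isSemisimpleRing_of_isReduced _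
  let μ := Algebra.TensorProduct.lmul' F (S := T)
  obtain ⟨g, hg, hgI⟩ := exists_mem_forall_mul_eq_self (RingHom.ker μ)
  refine Algebra.FormallyUnramified.iff_exists_tensorProduct.2 ⟨1 - g, fun t ↦ ?_, ?_⟩
  · have ht : 1 ⊗ₜ[F] t - t ⊗ₜ[F] 1 ∈ RingHom.ker μ := by simp [μ, RingHom.mem_ker]
    rw [mul_sub, mul_one, mul_comm, hgI _ ht, sub_self]
  · change μ (1 - g) = 1
    rw [map_sub, map_one, RingHom.mem_ker.1 hg, sub_zero]

end Unramified

section Semisimple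

theorem exists_isTwoSided_isCompl {R : Type*} [Ring R] [IsSemisimpleRing R] (I : Ideal R)
    [hI : I.IsTwoSided] : ∃ I' : Ideal R, I'.IsTwoSided ∧ IsCompl I I' := by
  have : ComplementedLattice (fullyInvariantSubmodule R R) :=
    OrderIso.setIsotypicComponents.complementedLattice
  obtain ⟨I', hI', hc⟩ := CompleteSublattice.isComplemented_iff.1 this I
    (isFullyInvariant_iff_isTwoSided.2 hI)
  exact ⟨I', isFullyInvariant_iff_isTwoSided.1 hI', hc⟩

end Semisimple

section Bimodule

open MulOpposite AlgHom

attribute [local instance] TensorProduct.Algebra.module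

variable {F R : Type*} [CommRing F] [Ring R] [Algebra F R]

theorem tmul_op_smul (a b x : R) : (a ⊗ₜ[F] op b) • x = a * x * b :=
  mulLeftRight_apply F R a (op b) x

variable (F R) in
theorem isSemisimpleModule_bimodule [IsSemisimpleRing R] :
    IsSemisimpleModule (R ⊗[F] Rᵐᵒᵖ) R := by
  refine { exists_isCompl := fun M ↦ ?_ }
  let I : Ideal R :=
    { M with
      smul_mem' := fun a x hx ↦ by
        change a * x ∈ M
        simpa only [tmul_op_smul, mul_one] using M.smul_mem (a ⊗ₜ op 1) hx }
  have : I.IsTwoSided := ⟨fun {x} b hx ↦ by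
    change x * b ∈ M
    simpa only [tmul_op_smul, one_mul] using M.smul_mem (1 ⊗ₜ op b) hx⟩
  obtain ⟨I', hI', hc⟩ := exists_isTwoSided_isCompl I
  let M' : Submodule (R ⊗[F] Rᵐᵒᵖ) R :=
    { I' with
      smul_mem' := fun t x hx ↦ by
        induction t with
        | zero => exact (zero_smul (R ⊗[F] Rᵐᵒᵖ) x).symm ▸ I'.zero_mem
        | tmul a b => exact I'.mul_mem_left a (I'.mul_mem_right b.unop hx)
        | add t u ht hu => exact (add_smul t u x).symm ▸ I'.add_mem ht hu }
  exact ⟨M', Submodule.disjoint_def.2 fun x hx hx' ↦ Submodule.disjoint_def.1 hc.disjoint x hx hx',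
    Submodule.codisjoint_iff_exists_add_eq.2 fun x ↦
      Submodule.codisjoint_iff_exists_add_eq.1 hc.codisjoint x⟩

/-- Bimodule endomorphisms of `R` are multiplications by central elements, so the density theorem
applies to any `f` commuting with these. -/
theorem exists_mulLeftRight_eq [IsSemisimpleRing R] [Module.Finite F R] (f : Module.End F R)
    (hf : ∀ z ∈ Subalgebra.center F R, ∀ x, f (z * x) = z * f x) :
    ∃ t, mulLeftRight F R t = f := by
  have := isSemisimpleModule_bimodule F R
  have apply_eq (g : Module.End (R ⊗[F] Rᵐᵒᵖ) R) (x : R) : g x = x * g 1 := by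
    simpa only [tmul_op_smul, mul_one] using g.map_smul (x ⊗ₜ op 1) 1
  have apply_eq' (g : Module.End (R ⊗[F] Rᵐᵒᵖ) R) (x : R) : g x = g 1 * x := by
    simpa only [tmul_op_smul, one_mul] using g.map_smul (1 ⊗ₜ op x) 1
  have map_one_mem_center (g : Module.End (R ⊗[F] Rᵐᵒᵖ) R) : g 1 ∈ Subalgebra.center F R :=
    Subalgebra.mem_center_iff.2 fun x ↦ (apply_eq g x).symm.trans (apply_eq' g x)
  let f' : Module.End (Module.End (R ⊗[F] Rᵐᵒᵖ) R) R :=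
    { f with
      map_smul' := fun g x ↦ by
        change f (g x) = g (f x)
        rw [apply_eq', hf _ (map_one_mem_center g), ← apply_eq'] }
  obtain ⟨s, hs⟩ := Module.Finite.fg_top (R := F) (M := R)
  obtain ⟨t, ht⟩ := jacobson_density f' s
  exact ⟨t, LinearMap.ext_on hs fun x hx ↦ (ht x hx).symm⟩

end Bimodule

section BimoduleAct

open MulOpposite AlgHom

variable {F K N : Type*} [CommRing F] [CommRing K] [Algebra F K] [Ring N] [Algebra F N]

/-- The homomorphism `k ⊗ k' ↦ i k ⊗ i k'` from `K ⊗ K` to the enveloping algebra of `N`; it is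
multiplicative in the second factor because `K` is commutative. -/
noncomputable def toEnvelopingAlgebra (i : K →ₐ[F] N) : K ⊗[F] K →ₐ[F] N ⊗[F] Nᵐᵒᵖ :=
  Algebra.TensorProduct.map i (i.toOpposite fun x y ↦ (Commute.all x y).map i)

@[simp]
theorem toEnvelopingAlgebra_tmul (i : K →ₐ[F] N) (k k' : K) :
    toEnvelopingAlgebra i (k ⊗ₜ k') = i k ⊗ₜ op (i k') := rfl

/-- The action `(k ⊗ k') x = i k * x * i k'` of `K ⊗ K` on `N`, which encodes the `K`-bimodule
structure of `N` defined by `i`. -/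
noncomputable def bimoduleAct (i : K →ₐ[F] N) : K ⊗[F] K →ₐ[F] Module.End F N :=
  (mulLeftRight F N).comp (toEnvelopingAlgebra i)

@[simp]
theorem bimoduleAct_tmul (i : K →ₐ[F] N) (k k' : K) (x : N) :
    bimoduleAct i (k ⊗ₜ k') x = i k * x * i k' :=
  mulLeftRight_apply F N (i k) (op (i k')) x

theorem bimoduleAct_apply (i : K →ₐ[F] N) (z : K ⊗[F] K) :
    bimoduleAct i z = mulLeftRight F N (toEnvelopingAlgebra i z) := rfl

theorem bimoduleAct_mul_left (i : K →ₐ[F] N) (z : K ⊗[F] K) (k : K) (x : N) :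
    bimoduleAct i z (i k * x) = i k * bimoduleAct i z x := by
  have h : ∀ y, i k * y = bimoduleAct i (k ⊗ₜ 1) y := fun y ↦ by simp
  rw [h, h, ← Module.End.mul_apply, ← Module.End.mul_apply, ← map_mul, ← map_mul, mul_comm]

theorem bimoduleAct_mul_right (i : K →ₐ[F] N) (z : K ⊗[F] K) (k : K) (x : N) :
    bimoduleAct i z (x * i k) = bimoduleAct i z x * i k := by
  have h : ∀ y, y * i k = bimoduleAct i (1 ⊗ₜ k) y := fun y ↦ by simp
  rw [h, h, ← Module.End.mul_apply, ← Module.End.mul_apply, ← map_mul, ← map_mul, mul_comm]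

theorem bimoduleAct_eq_mul {i : K →ₐ[F] N} {x : N} (hx : ∀ k, Commute (i k) x) (z : K ⊗[F] K) :
    bimoduleAct i z x = i (Algebra.TensorProduct.lmul' F z) * x := by
  induction z with
  | zero => simp
  | tmul a b => simp [mul_assoc, (hx b).eq]
  | add a b ha hb => simp [ha, hb, add_mul]

theorem bimoduleAct_mem (i : K →ₐ[F] N) (I : Ideal N) [I.IsTwoSided] (z : K ⊗[F] K) {x : N}
    (hx : x ∈ I) : bimoduleAct i z x ∈ I := by
  induction z with
  | zero => simp
  | tmul a b => exact bimoduleAct_tmul i a b x ▸ I.mul_mem_right _ (I.mul_mem_left _ hx)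
  | add a b ha hb =>
    rw [map_add, LinearMap.add_apply]
    exact I.add_mem ha hb

theorem map_bimoduleAct {N' : Type*} [Ring N'] [Algebra F N'] (f : N →ₐ[F] N') (i : K →ₐ[F] N)
    (z : K ⊗[F] K) (x : N) : f (bimoduleAct i z x) = bimoduleAct (f.comp i) z (f x) := by
  induction z with
  | zero => simp
  | tmul a b => simp
  | add a b ha hb => simp [ha, hb]

theorem toEnvelopingAlgebra_comp {Z : Type*} [CommRing Z] [Algebra F Z] (i : K →ₐ[F] N)
    (ρ : Z →ₐ[F] K) (z : Z ⊗[F] Z) :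
    toEnvelopingAlgebra (i.comp ρ) z =
      toEnvelopingAlgebra i (Algebra.TensorProduct.map ρ ρ z) := by
  induction z with
  | zero => simp
  | tmul a b => simp
  | add a b ha hb => simp [ha, hb]

section FormallyUnramified

open Algebra.FormallyUnramified

variable [Algebra.FormallyUnramified F K] [Algebra.EssFiniteType F K]

theorem tmul_one_mul_toEnvelopingAlgebra_elem (i : K →ₐ[F] N) (k : K) :
    (i k ⊗ₜ 1) * toEnvelopingAlgebra i (elem F K) =
      (1 ⊗ₜ op (i k)) * toEnvelopingAlgebra i (elem F K) := by
  have h := congrArg (toEnvelopingAlgebra i) (one_tmul_mul_elem (R := F) k).symm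
  rwa [map_mul, map_mul, toEnvelopingAlgebra_tmul, toEnvelopingAlgebra_tmul, map_one, op_one] at h

theorem bimoduleAct_elem_of_commute {i : K →ₐ[F] N} {x : N} (hx : ∀ k, Commute (i k) x) :
    bimoduleAct i (elem F K) x = x := by
  have h : Algebra.TensorProduct.lmul' F (elem F K) = 1 := lmul_elem
  rw [bimoduleAct_eq_mul hx, h, map_one, one_mul]

end FormallyUnramified

end BimoduleAct

section Azumaya

theorem exists_sum_smul_eq_of_projective (Z M : Type*) [Ring Z] [AddCommGroup M] [Module Z M]
    [Module.Finite Z M] [Module.Projective Z M] :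
    ∃ (n : ℕ) (b : Fin n → M) (c : Fin n → M →ₗ[Z] Z), ∀ x, ∑ l, c l x • b l = x := by
  obtain ⟨n, f, g, -, -, hfg⟩ := Module.Finite.exists_comp_eq_id_of_projective Z M
  refine ⟨n, fun l ↦ f (Pi.single l 1), fun l ↦ LinearMap.proj l ∘ₗ g, fun x ↦ ?_⟩
  calc ∑ l, g x l • f (Pi.single l 1) = f (∑ l, Pi.single l (g x l)) := by
        rw [map_sum]
        refine Finset.sum_congr rfl fun l _ ↦ ?_
        rw [← map_smul, ← Pi.single_smul, smul_eq_mul, mul_one]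
    _ = x := by rw [Finset.univ_sum_single, ← LinearMap.comp_apply, hfg, LinearMap.id_apply]

open MulOpposite AlgHom

section MulApply

variable {F R : Type*} [CommRing F] [Ring R] [Algebra F R]

/-- The linear map `a ⊗ b ↦ a * f b`, which reads off the coordinates of an element of the
enveloping algebra when `f` is a coordinate function on the second factor. -/
noncomputable def mulApply (f : Module.End F R) : R ⊗[F] Rᵐᵒᵖ →ₗ[F] R :=
  LinearMap.mul' F R ∘ₗ TensorProduct.map LinearMap.id (f ∘ₗ (opLinearEquiv F).symm.toLinearMap)

@[simp]
theorem mulApply_tmul (f : Module.End F R) (a b : R) :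
    mulApply f (a ⊗ₜ op b) = a * f b := rfl

theorem mulApply_mulLeftRight_eq_zero {t : R ⊗[F] Rᵐᵒᵖ} (ht : mulLeftRight F R t = 0)
    (u : R ⊗[F] Rᵐᵒᵖ) : mulApply (mulLeftRight F R u) t = 0 := by
  have mulApply_tmul_eq (c d : R) (t : R ⊗[F] Rᵐᵒᵖ) :
      mulApply (mulLeftRight F R (c ⊗ₜ op d)) t = mulLeftRight F R t c * d := by
    induction t with
    | zero => simp
    | tmul a b =>
      obtain ⟨b, rfl⟩ := op_surjective b
      simp [mul_assoc]
    | add t t' h h' => simp [h, h', add_mul]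
  induction u with
  | zero => simp [mulApply]
  | tmul c d =>
    obtain ⟨d, rfl⟩ := op_surjective d
    rw [mulApply_tmul_eq, ht, LinearMap.zero_apply, zero_mul]
  | add u u' h h' =>
    rw [map_add, mulApply, LinearMap.add_comp, TensorProduct.map_add_right, LinearMap.comp_add,
      LinearMap.add_apply]
    exact (congrArg₂ (· + ·) h h').trans (add_zero 0)

end MulApply

variable {F R : Type*} [Field F] [Ring R] [Algebra F R] [Module.Finite F R] [IsSemisimpleRing R]
  [Algebra.FormallyUnramified F (Subalgebra.center F R)]

/-- Multiplication by `s` factors through `R ⊗ Rᵐᵒᵖ` over the center `Z`, which acts faithfully on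
`R` since `R` is Azumaya over `Z`. Expanding the second factor in a dual basis of `R` over `Z` makes
this explicit without tensor products over `Z`. -/
theorem mul_eq_zero_of_mulLeftRight_eq_zero {t s : R ⊗[F] Rᵐᵒᵖ} (ht : mulLeftRight F R t = 0)
    (hs : ∀ z ∈ Subalgebra.center F R, (z ⊗ₜ 1) * s = (1 ⊗ₜ op z) * s) : t * s = 0 := by
  have := Algebra.FormallyUnramified.projective_of_restrictScalars F (Subalgebra.center F R) R
  have : Module.Finite (Subalgebra.center F R) R := Module.Finite.of_restrictScalars_finite F _ _
  obtain ⟨n, b, g, hbg⟩ := exists_sum_smul_eq_of_projective (Subalgebra.center F R) R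
  let c (l : Fin n) : Module.End F R :=
    (Subalgebra.center F R).val.toLinearMap ∘ₗ (g l).restrictScalars F
  have sum_coord (x : R) : ∑ l, c l x * b l = x := hbg x
  have coord_linear (l : Fin n) : ∃ u, mulLeftRight F R u = c l := by
    refine exists_mulLeftRight_eq _ fun z hz x ↦
      congrArg Subtype.val ((g l).map_smul ⟨z, hz⟩ x)
  have mul_eq_sum (t : R ⊗[F] Rᵐᵒᵖ) :
      t * s = ∑ l, (mulApply (c l) t ⊗ₜ op (b l)) * s := by
    induction t with
    | zero => simp
    | add t t' h h' => simp [h, h', add_mul, TensorProduct.add_tmul, Finset.sum_add_distrib]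
    | tmul x y =>
      obtain ⟨y, rfl⟩ := op_surjective y
      calc (x ⊗ₜ op y) * s = ∑ l, (x ⊗ₜ op (b l)) * ((1 ⊗ₜ op (c l y : R)) * s) := by
            conv_lhs => rw [← sum_coord y, Finset.op_sum, TensorProduct.tmul_sum, Finset.sum_mul]
            simp [← mul_assoc]
        _ = ∑ l, (mulApply (c l) (x ⊗ₜ op y) ⊗ₜ op (b l)) * s := by
            refine Finset.sum_congr rfl fun l _ ↦ ?_
            rw [← hs (c l y) (g l y).2, ← mul_assoc, Algebra.TensorProduct.tmul_mul_tmul, mul_one,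
              mulApply_tmul]
  rw [mul_eq_sum]
  refine Finset.sum_eq_zero fun l _ ↦ ?_
  obtain ⟨u, hu⟩ := coord_linear l
  rw [← hu, mulApply_mulLeftRight_eq_zero ht, TensorProduct.zero_tmul, zero_mul]

end Azumaya

section Separable

open MulOpposite AlgHom

attribute [local instance] TensorProduct.Algebra.module

variable {F R : Type*} [Field F] [Ring R] [Algebra F R]

theorem isSeparableAlgebra_of_separabilityElement (p : R ⊗[F] Rᵐᵒᵖ)
    (hp : ∀ r : R, (r ⊗ₜ 1) * p = (1 ⊗ₜ op r) * p) (hp1 : mulLeftRight F R p 1 = 1) :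
    IsSeparableAlgebra F R := by
  have map_smul (z : R ⊗[F] Rᵐᵒᵖ) (r : R) :
      (mulLeftRight F R z r ⊗ₜ 1) * p = z * ((r ⊗ₜ 1) * p) := by
    induction z with
    | zero => simp
    | add x y hx hy =>
      rw [map_add, LinearMap.add_apply, TensorProduct.add_tmul, add_mul, hx, hy, add_mul]
    | tmul a b =>
      calc (mulLeftRight F R (a ⊗ₜ b) r ⊗ₜ 1) * p
          = ((a * r) ⊗ₜ 1) * ((b.unop ⊗ₜ 1) * p) := by simp [← mul_assoc]
        _ = ((a * r) ⊗ₜ 1) * ((1 ⊗ₜ b) * p) := by rw [hp, op_unop]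
        _ = (a ⊗ₜ b) * ((r ⊗ₜ 1) * p) := by simp [← mul_assoc]
  let f : R →ₗ[R ⊗[F] Rᵐᵒᵖ] R ⊗[F] Rᵐᵒᵖ :=
    { toFun := fun r ↦ (r ⊗ₜ 1) * p
      map_add' := fun x y ↦ by rw [TensorProduct.add_tmul, add_mul]
      map_smul' := map_smul }
  refine Module.Projective.of_split f (LinearMap.toSpanSingleton _ R (1 : R)) ?_
  refine LinearMap.ext fun r ↦ ?_
  calc ((r ⊗ₜ 1) * p) • (1 : R) = (r ⊗ₜ op 1) • p • (1 : R) := mul_smul _ _ _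
    _ = r := by rw [show p • (1 : R) = 1 from hp1, tmul_op_smul, mul_one, mul_one]

variable [Module.Finite F R] [IsSemisimpleRing R]
  [Algebra.FormallyUnramified F (Subalgebra.center F R)]

variable (F R) in
theorem exists_mulLeftRight_mem_center : ∃ t : R ⊗[F] Rᵐᵒᵖ,
    (∀ x, mulLeftRight F R t x ∈ Subalgebra.center F R) ∧
      ∀ z ∈ Subalgebra.center F R, mulLeftRight F R t z = z := by
  let Z := Subalgebra.center F R
  have : IsSemisimpleRing Z := isSemisimpleRing_of_formallyUnramified F Z
  let incl : Z →ₗ[Z] R := { Z.val with map_smul' := fun _ _ ↦ rfl }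
  obtain ⟨e, he⟩ := IsSemisimpleModule.extension_property incl
    Subtype.val_injective LinearMap.id
  obtain ⟨t, ht⟩ := exists_mulLeftRight_eq (Z.val.toLinearMap ∘ₗ e.restrictScalars F)
    fun z hz x ↦ congrArg Subtype.val (e.map_smul ⟨z, hz⟩ x)
  refine ⟨t, fun x ↦ ht ▸ (e x).2, fun z hz ↦ ?_⟩
  rw [ht]
  exact congrArg Subtype.val (LinearMap.congr_fun he ⟨z, hz⟩)

open Algebra.FormallyUnramified in
variable (F R) in
theorem isSeparableAlgebra_of_formallyUnramified_center : IsSeparableAlgebra F R := by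
  let Z := Subalgebra.center F R
  let s : R ⊗[F] Rᵐᵒᵖ := toEnvelopingAlgebra Z.val (elem F Z)
  obtain ⟨t, ht, htZ⟩ := exists_mulLeftRight_mem_center F R
  refine isSeparableAlgebra_of_separabilityElement (t * s) (fun r ↦ ?_) ?_
  · rw [← sub_eq_zero, ← mul_assoc, ← mul_assoc, ← sub_mul, ← sub_mul]
    refine mul_eq_zero_of_mulLeftRight_eq_zero (LinearMap.ext fun x ↦ ?_)
      fun z hz ↦ tmul_one_mul_toEnvelopingAlgebra_elem Z.val ⟨z, hz⟩
    have hc := Subalgebra.mem_center_iff.1 (ht x) r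
    rw [sub_mul, map_sub, map_mul, map_mul]
    simp [hc]
  · rw [map_mul, Module.End.mul_apply, ← bimoduleAct_apply,
      bimoduleAct_elem_of_commute fun z ↦ Commute.one_right _, htZ 1 (one_mem Z)]

end Separable

section BimoduleEmbedding

open Algebra.FormallyUnramified

variable {F K N : Type*} [Field F] [CommRing K] [Algebra F K] [Ring N] [Algebra F N]

/-- The map `θ` embeds `N` into `K ⊗ K` as a `K`-bimodule, where `K` acts on `N` through an
embedding `i` of algebras; the nucleus of a semiassociative algebra is an example. -/
structure IsBimoduleEmbedding (i : K →ₐ[F] N) (θ : N →ₗ[F] K ⊗[F] K) : Prop where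
  inj_hom : Function.Injective i
  inj_map : Function.Injective θ
  map_mul_mul : ∀ k k' x, θ (i k * x * i k') = (k ⊗ₜ k') * θ x

/-- The element `g` of `K ⊗ K` acts on `N` as a linear projection onto the ideal `I`; its kernel is
then a sub-bimodule complementing `I`. -/
structure IsBimoduleProjection (i : K →ₐ[F] N) (g : K ⊗[F] K) (I : Ideal N) : Prop where
  act_mem : ∀ x, bimoduleAct i g x ∈ I
  act_eq_self : ∀ x ∈ I, bimoduleAct i g x = x

namespace IsBimoduleEmbedding

variable {i : K →ₐ[F] N} {θ : N →ₗ[F] K ⊗[F] K}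

theorem map_act (h : IsBimoduleEmbedding i θ) (z : K ⊗[F] K) (x : N) :
    θ (bimoduleAct i z x) = z * θ x := by
  induction z with
  | zero => simp
  | tmul a b => rw [bimoduleAct_tmul, h.map_mul_mul]
  | add a b ha hb => rw [map_add, LinearMap.add_apply, map_add, ha, hb, add_mul]

theorem exists_isBimoduleProjection [IsSemisimpleRing (K ⊗[F] K)] (h : IsBimoduleEmbedding i θ)
    (I : Ideal N) [I.IsTwoSided] : ∃ g, IsBimoduleProjection i g I := by
  let I' : Ideal (K ⊗[F] K) :=
    { (I.restrictScalars F).map θ with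
      smul_mem' := by
        rintro z _ ⟨x, hx, rfl⟩
        exact ⟨bimoduleAct i z x, bimoduleAct_mem i I z hx, h.map_act z x⟩ }
  obtain ⟨g, hg, hgI⟩ := exists_mem_forall_mul_eq_self I'
  refine ⟨g, fun x ↦ ?_, fun x hx ↦ h.inj_map ?_⟩
  · obtain ⟨y, hy, hxy⟩ := I'.mul_mem_right (θ x) hg
    rw [← h.map_act] at hxy
    exact h.inj_map hxy ▸ hy
  · rw [h.map_act]
    exact hgI _ ⟨x, hx, rfl⟩

theorem exists_quotient {I : Ideal N} [I.IsTwoSided] {g : K ⊗[F] K} (h : IsBimoduleEmbedding i θ)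
    (hg : IsBimoduleProjection i g I) (hI : ∀ k, i k ∈ I → k = 0) :
    ∃ θ', IsBimoduleEmbedding ((Ideal.Quotient.mkₐ F I).comp i) θ' := by
  let π := Ideal.Quotient.mkₐ F I
  have hπ : Function.Surjective π := Ideal.Quotient.mkₐ_surjective F I
  obtain ⟨σ, hσ⟩ := π.toLinearMap.exists_rightInverse_of_surjective (LinearMap.range_eq_top.2 hπ)
  have π_σ (y) : π (σ y) = y := LinearMap.congr_fun hσ y
  let e := bimoduleAct i (1 - g)
  have e_apply (x : N) : e x = x - bimoduleAct i g x := by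
    simp [e]
  have e_σ_π (x : N) : e (σ (π x)) = e x := by
    have hx : σ (π x) - x ∈ I := Ideal.Quotient.eq.1 (π_σ (π x))
    rw [← sub_eq_zero, ← map_sub, e_apply, hg.act_eq_self _ hx, sub_self]
  refine ⟨θ ∘ₗ e ∘ₗ σ, ?_, ?_, fun k k' y ↦ ?_⟩
  · exact (injective_iff_map_eq_zero _).2 fun k hk ↦ hI k (Ideal.Quotient.eq_zero_iff_mem.1 hk)
  · refine (injective_iff_map_eq_zero _).2 fun y hy ↦ ?_
    have he : e (σ y) = 0 := h.inj_map (hy.trans (map_zero θ).symm)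
    rw [e_apply, sub_eq_zero] at he
    rw [← π_σ y, he]
    exact Ideal.Quotient.eq_zero_iff_mem.2 (hg.act_mem _)
  · obtain ⟨x, rfl⟩ := hπ y
    have hx : π (i k) * π x * π (i k') = π (i k * x * i k') := by simp only [map_mul]
    change θ (e (σ (π (i k) * π x * π (i k')))) = (k ⊗ₜ k') * θ (e (σ (π x)))
    rw [hx, e_σ_π, e_σ_π]
    simp only [e]
    rw [bimoduleAct_mul_right, bimoduleAct_mul_left, h.map_mul_mul]

variable [Module.Finite F K] [Algebra.FormallyUnramified F K]

theorem centralizer_range (h : IsBimoduleEmbedding i θ) :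
    Subalgebra.centralizer F (Set.range i) = i.range := by
  have : Module.Finite F N := Module.Finite.of_injective θ h.inj_map
  let f : K →ₗ[F] K ⊗[F] K :=
    LinearMap.mulRight F (elem F K) ∘ₗ (Algebra.TensorProduct.includeLeft).toLinearMap
  have mul_elem_mem (z : K ⊗[F] K) : z * elem F K ∈ LinearMap.range f := by
    induction z with
    | zero => simp
    | tmul a b =>
      refine ⟨a * b, ?_⟩
      calc ((a * b) ⊗ₜ 1) * elem F K = (a ⊗ₜ 1) * ((b ⊗ₜ 1) * elem F K) := by simp [← mul_assoc]
        _ = (a ⊗ₜ b) * elem F K := by rw [← one_tmul_mul_elem]; simp [← mul_assoc]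
    | add a b ha hb => exact add_mul a b (elem F K) ▸ add_mem ha hb
  let C := Subalgebra.toSubmodule (Subalgebra.centralizer F (Set.range i))
  have map_le : C.map θ ≤ LinearMap.range f := by
    rintro _ ⟨x, hx, rfl⟩
    rw [← bimoduleAct_elem_of_commute fun k ↦ hx (i k) ⟨k, rfl⟩, h.map_act, mul_comm]
    exact mul_elem_mem _
  refine (Subalgebra.toSubmodule_injective (Submodule.eq_of_le_of_finrank_le ?_ ?_)).symm
  · rintro _ ⟨k, rfl⟩ _ ⟨k', rfl⟩
    exact ((Commute.all k' k).map i).eq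
  · calc Module.finrank F C = Module.finrank F (C.map θ) :=
          (Submodule.equivMapOfInjective θ h.inj_map C).finrank_eq
      _ ≤ Module.finrank F (LinearMap.range f) := Submodule.finrank_mono map_le
      _ ≤ Module.finrank F K := LinearMap.finrank_range_le f
      _ = _ := (LinearMap.finrank_range_of_inj (f := i.toLinearMap) h.inj_hom).symm

theorem exists_center_lift (h : IsBimoduleEmbedding i θ) :
    ∃ ρ : Subalgebra.center F N →ₐ[F] K, i.comp ρ = (Subalgebra.center F N).val := by
  let φ := AlgEquiv.ofInjective i h.inj_hom
  have hle : Subalgebra.center F N ≤ i.range :=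
    h.centralizer_range ▸ Subalgebra.center_le_centralizer F _
  refine ⟨φ.symm.toAlgHom.comp (Subalgebra.inclusion hle), AlgHom.ext fun z ↦ ?_⟩
  exact congrArg Subtype.val (φ.apply_symm_apply (Subalgebra.inclusion hle z))

theorem formallyUnramified_center (h : IsBimoduleEmbedding i θ) :
    Algebra.FormallyUnramified F (Subalgebra.center F N) := by
  obtain ⟨ρ, hρ⟩ := h.exists_center_lift
  refine formallyUnramified_of_injective (f := ρ) (Function.Injective.of_comp (f := i) ?_)
  rw [← AlgHom.coe_comp, hρ]
  exact Subtype.val_injective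

end IsBimoduleEmbedding

end BimoduleEmbedding

section Splitting

open MulOpposite Algebra.FormallyUnramified

theorem exists_algHom_quotient_of_isCompl {F N : Type*} [CommRing F] [Ring N] [Algebra F N]
    {S : Subalgebra F N} {I : Ideal N} [I.IsTwoSided]
    (h : IsCompl (Subalgebra.toSubmodule S) (I.restrictScalars F)) :
    ∃ s : N ⧸ I →ₐ[F] N, s.range = S ∧ ∀ x, Ideal.Quotient.mk I (s x) = x := by
  let f : S →ₐ[F] N ⧸ I := (Ideal.Quotient.mkₐ F I).comp S.val
  have inj : Function.Injective f := (injective_iff_map_eq_zero f).2 fun x hx ↦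
    Subtype.ext (Submodule.disjoint_def.1 h.disjoint x x.2 (Ideal.Quotient.eq_zero_iff_mem.1 hx))
  have surj : Function.Surjective f := fun y ↦ by
    obtain ⟨y, rfl⟩ := Ideal.Quotient.mk_surjective y
    obtain ⟨x, z, hx, hz, rfl⟩ := Submodule.codisjoint_iff_exists_add_eq.1 h.codisjoint y
    refine ⟨⟨x, hx⟩, Ideal.Quotient.eq.2 ?_⟩
    simpa using hz
  let φ := AlgEquiv.ofBijective f ⟨inj, surj⟩
  refine ⟨S.val.comp φ.symm.toAlgHom, ?_, φ.apply_symm_apply⟩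
  exact SetLike.coe_injective ((φ.symm.surjective.range_comp S.val).trans Subtype.range_val)

section Faithful

variable {F K R : Type*} [Field F] [CommRing K] [Algebra F K] [Ring R] [Algebra F R]
  [Module.Finite F R] [IsSemisimpleRing R] [Algebra.FormallyUnramified F (Subalgebra.center F R)]

theorem mul_map_elem_eq_zero {j : K →ₐ[F] R} (hj : Function.Injective j)
    {ρ : Subalgebra.center F R →ₐ[F] K} (hρ : j.comp ρ = (Subalgebra.center F R).val)
    {w : K ⊗[F] K} (hw : bimoduleAct j w = 0) :
    w * Algebra.TensorProduct.map ρ ρ (elem F (Subalgebra.center F R)) = 0 := by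
  have inj : Function.Injective (toEnvelopingAlgebra j) :=
    TensorProduct.map_injective_of_flat_flat _ _ hj (op_injective.comp hj)
  refine inj ?_
  rw [map_mul, map_zero, ← toEnvelopingAlgebra_comp, hρ]
  exact mul_eq_zero_of_mulLeftRight_eq_zero hw fun z hz ↦
    tmul_one_mul_toEnvelopingAlgebra_elem (Subalgebra.center F R).val ⟨z, hz⟩

end Faithful

variable {F K N : Type*} [Field F] [CommRing K] [Algebra F K] [Ring N] [Algebra F N]
  {I : Ideal N} [I.IsTwoSided] [Module.Finite F (N ⧸ I)] [IsSemisimpleRing (N ⧸ I)]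
  [Algebra.FormallyUnramified F (Subalgebra.center F (N ⧸ I))]
  {i : K →ₐ[F] N} {g : K ⊗[F] K} {ρ : Subalgebra.center F (N ⧸ I) →ₐ[F] K}

theorem IsBimoduleProjection.act_eq_zero_iff_mem_centralizer (hg : IsBimoduleProjection i g I)
    (hj : Function.Injective ((Ideal.Quotient.mkₐ F I).comp i))
    (hρ : ((Ideal.Quotient.mkₐ F I).comp i).comp ρ = (Subalgebra.center F (N ⧸ I)).val) {x : N} :
    bimoduleAct i g x = 0 ↔ x ∈ Subalgebra.centralizer F (Set.range (i.comp ρ)) := by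
  let π := Ideal.Quotient.mkₐ F I
  have π_eq_zero {x : N} : π x = 0 ↔ x ∈ I := Ideal.Quotient.eq_zero_iff_mem
  constructor
  · rintro hx _ ⟨z, rfl⟩
    have commutator_mem : i (ρ z) * x - x * i (ρ z) ∈ I := by
      have hz : π (i (ρ z)) = z := AlgHom.congr_fun hρ z
      rw [← π_eq_zero, map_sub, map_mul, map_mul, hz, sub_eq_zero]
      exact (Subalgebra.mem_center_iff.1 z.2 (π x)).symm
    refine sub_eq_zero.1 ((hg.act_eq_self _ commutator_mem).symm.trans ?_)
    rw [map_sub, bimoduleAct_mul_left, bimoduleAct_mul_right, hx, mul_zero, zero_mul, sub_zero]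
  · intro hx
    have act_quotient : bimoduleAct (π.comp i) g = 0 := LinearMap.ext fun y ↦ by
      obtain ⟨x, rfl⟩ := Ideal.Quotient.mkₐ_surjective F I y
      exact (map_bimoduleAct π i g x).symm.trans (π_eq_zero.2 (hg.act_mem x))
    rw [← bimoduleAct_elem_of_commute fun z ↦ hx _ ⟨z, rfl⟩, bimoduleAct_apply (i.comp ρ),
      toEnvelopingAlgebra_comp, ← bimoduleAct_apply, ← Module.End.mul_apply, ← map_mul,
      mul_map_elem_eq_zero hj hρ act_quotient, map_zero, LinearMap.zero_apply]

theorem IsBimoduleProjection.isCompl_centralizer (hg : IsBimoduleProjection i g I)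
    (hj : Function.Injective ((Ideal.Quotient.mkₐ F I).comp i))
    (hρ : ((Ideal.Quotient.mkₐ F I).comp i).comp ρ = (Subalgebra.center F (N ⧸ I)).val) :
    IsCompl (Subalgebra.toSubmodule (Subalgebra.centralizer F (Set.range (i.comp ρ))))
      (I.restrictScalars F) := by
  have act_eq_zero_iff {x : N} := hg.act_eq_zero_iff_mem_centralizer hj hρ (x := x)
  refine ⟨Submodule.disjoint_def.2 fun x hx hxI ↦ ?_,
    Submodule.codisjoint_iff_exists_add_eq.2 fun x ↦
      ⟨x - bimoduleAct i g x, _, act_eq_zero_iff.1 ?_, hg.act_mem x, sub_add_cancel x _⟩⟩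
  · exact (hg.act_eq_self x hxI).symm.trans (act_eq_zero_iff.2 hx)
  · rw [map_sub, hg.act_eq_self _ (hg.act_mem x), sub_self]

end Splitting

section Wedderburn

theorem eq_zero_of_map_mem_jacobson {F K N : Type*} [CommRing F] [CommRing K] [Algebra F K] [Ring N]
    [Algebra F N] [IsReduced K] [IsArtinianRing N] {i : K →ₐ[F] N}
    (hi : Function.Injective i) {k : K} (hk : i k ∈ Ring.jacobson N) : k = 0 := by
  obtain ⟨n, hn⟩ := IsSemiprimaryRing.isNilpotent (R := N)
  have h := Ideal.pow_mem_pow hk n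
  rw [hn, ← map_pow] at h
  exact eq_zero_of_pow_eq_zero (hi (h.trans (map_zero i).symm))

variable {F K N : Type*} [Field F] [CommRing K] [Algebra F K] [Module.Finite F K]
  [Algebra.FormallyUnramified F K] [Ring N] [Algebra F N] {i : K →ₐ[F] N} {θ : N →ₗ[F] K ⊗[F] K}

theorem IsBimoduleEmbedding.separable_and_exists_section (h : IsBimoduleEmbedding i θ) :
    IsSeparableAlgebra F (N ⧸ Ring.jacobson N) ∧
    ∃ s : N ⧸ Ring.jacobson N →ₐ[F] N,
      (∀ x, Ideal.Quotient.mk (Ring.jacobson N) (s x) = x) ∧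
      IsCompl (Subalgebra.toSubmodule s.range) ((Ring.jacobson N).restrictScalars F) := by
  have : Module.Finite F N := Module.Finite.of_injective θ h.inj_map
  have : IsArtinianRing N := IsArtinianRing.of_finite F N
  have : IsReduced K := Algebra.FormallyUnramified.isReduced_of_field F K
  have := isSemisimpleRing_tensorProduct F K
  obtain ⟨g, hg⟩ := h.exists_isBimoduleProjection (Ring.jacobson N)
  obtain ⟨θ', h'⟩ := h.exists_quotient hg fun k ↦ eq_zero_of_map_mem_jacobson h.inj_hom
  have := h'.formallyUnramified_center
  obtain ⟨ρ, hρ⟩ := h'.exists_center_lift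
  have hc := hg.isCompl_centralizer h'.inj_hom hρ
  obtain ⟨s, hs, hsec⟩ := exists_algHom_quotient_of_isCompl hc
  exact ⟨isSeparableAlgebra_of_formallyUnramified_center F _, s, hsec, hs ▸ hc⟩

end Wedderburn

section MinimallyFaithful

variable {T M : Type*} [CommRing T] [IsSemisimpleRing T] [AddCommGroup M] [Module T M]

variable (T M) in
theorem exists_torsionOf_eq_bot [FaithfulSMul T M] : ∃ a : M, Ideal.torsionOf T M a = ⊥ := by
  obtain ⟨_, ⟨a, rfl⟩, hmin⟩ :=
    IsArtinian.set_has_minimal (Set.range (Ideal.torsionOf T M)) ⟨_, 0, rfl⟩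
  obtain ⟨g, hga, hg⟩ := exists_mem_forall_mul_eq_self (Ideal.torsionOf T M a)
  rw [Ideal.mem_torsionOf_iff] at hga
  have hgg (m : M) : g • g • m = g • m := by rw [smul_smul, hg g hga]
  have torsion_le (m : M) : Ideal.torsionOf T M (a + g • m) ≤ Ideal.torsionOf T M a := by
    intro y hy
    rw [Ideal.mem_torsionOf_iff, smul_add] at *
    have hygm : y • g • m = 0 := by
      simpa only [smul_add, smul_comm g y, hga, hgg, smul_zero, zero_add] using congrArg (g • ·) hy
    rwa [hygm, add_zero] at hy
  have smul_eq_zero (m : M) : g • m = 0 := by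
    have hmem : g ∈ Ideal.torsionOf T M (a + g • m) := by
      rw [(torsion_le m).eq_of_not_lt (hmin _ ⟨_, rfl⟩)]
      exact hga
    rwa [Ideal.mem_torsionOf_iff, smul_add, hga, zero_add, hgg] at hmem
  have hg0 : g = 0 := FaithfulSMul.eq_of_smul_eq_smul fun m : M ↦ by rw [smul_eq_zero, zero_smul]
  exact ⟨a, (Submodule.eq_bot_iff _).2 fun z hz ↦ by rw [← hg z hz, hg0, zero_mul]⟩

theorem IsMinimallyFaithful.nonempty_linearEquiv (h : IsMinimallyFaithful T M) :
    Nonempty (M ≃ₗ[T] T) := by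
  obtain ⟨hfaithful, hmin⟩ := h
  obtain ⟨a, ha⟩ := exists_torsionOf_eq_bot T M
  let f := LinearMap.toSpanSingleton T M a
  have eq_zero {z : T} (hz : z • a = 0) : z = 0 := (Submodule.eq_bot_iff _).1 ha z hz
  have hf : FaithfulSMul T (LinearMap.range f ⧸ (⊥ : Submodule T M).submoduleOf _) := by
    refine ⟨fun {z w} hzw ↦ sub_eq_zero.1 (eq_zero ?_)⟩
    have h := hzw (Submodule.Quotient.mk ⟨a, 1, one_smul T a⟩)
    rw [← Submodule.Quotient.mk_smul, ← Submodule.Quotient.mk_smul, Submodule.Quotient.eq] at h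
    exact (sub_smul z w a).trans h
  obtain ⟨-, htop⟩ := hmin ⊥ (LinearMap.range f) bot_le hf
  exact ⟨(LinearEquiv.ofBijective f ⟨(injective_iff_map_eq_zero f).2 fun _ ↦ eq_zero,
    LinearMap.range_eq_top.1 htop⟩).symm⟩

end MinimallyFaithful

section NucleusEmbedding

open scoped IsMulCommutative

variable {F A : Type*} [Field F] [NonAssocRing A] [Module F A] [IsScalarTower F A A]
  [SMulCommClass F A A] {K : Subalgebra F (nucleus A)} [IsMulCommutative K]

theorem IsMinimallyFaithfulOver.exists_isBimoduleEmbedding [IsSemisimpleRing (K ⊗[F] K)]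
    (h : IsMinimallyFaithfulOver F A K) :
    ∃ θ : nucleus A →ₗ[F] K ⊗[F] K, IsBimoduleEmbedding K.val θ := by
  let _ : Module (K ⊗[F] K) A := Module.compHom A (nucBiact F A K).toRingHom
  obtain ⟨φ⟩ := IsMinimallyFaithful.nonempty_linearEquiv (T := K ⊗[F] K) (M := A) h
  have tmul_smul (k k' : K) (a : A) : (k ⊗ₜ[F] k') • a = (k : nucleus A) * a * (k' : nucleus A) :=
    nucBiact_tmul F A K k k' a
  have algebraMap_smul (c : F) (a : A) : algebraMap F (K ⊗[F] K) c • a = c • a :=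
    LinearMap.congr_fun ((nucBiact F A K).commutes c) a
  let θ : nucleus A →ₗ[F] K ⊗[F] K :=
    { toFun := fun x ↦ φ x
      map_add' := fun x y ↦ φ.map_add x y
      map_smul' := fun c x ↦ by
        change φ (c • (x : A)) = c • φ x
        rw [← algebraMap_smul, φ.map_smul, smul_eq_mul, ← Algebra.smul_def] }
  refine ⟨θ, Subtype.val_injective, φ.injective.comp Subtype.val_injective, fun k k' x ↦ ?_⟩
  calc φ ((k : nucleus A) * x * (k' : nucleus A)) = φ ((k ⊗ₜ[F] k') • (x : A)) := by rw [tmul_smul]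
    _ = (k ⊗ₜ k') * φ x := φ.map_smul _ _

theorem mainTheorem7_general [Algebra.Etale F K] (h : IsMinimallyFaithfulOver F A K) :
    IsSeparableAlgebra F (semisimpleQuotient A) ∧
    ∃ s : semisimpleQuotient A →ₐ[F] nucleus A,
      Function.Injective s ∧
      (∀ x : semisimpleQuotient A, Ideal.Quotient.mk (Ring.jacobson (nucleus A)) (s x) = x) ∧
      IsCompl (Subalgebra.toSubmodule s.range)
        ((Ring.jacobson (nucleus A)).restrictScalars F) := by
  have : Module.Finite F K := Algebra.FormallyUnramified.finite_of_free F K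
  have := isSemisimpleRing_tensorProduct F K
  obtain ⟨θ, hθ⟩ := h.exists_isBimoduleEmbedding
  obtain ⟨hsep, s, hs, hc⟩ := hθ.separable_and_exists_section
  exact ⟨hsep, s, Function.LeftInverse.injective hs, hs, hc⟩

end NucleusEmbedding

theorem mainTheorem7 {F A : Type*} [Field F] [NonAssocRing A] [Module F A] [IsScalarTower F A A]
    [SMulCommClass F A A] (hA : IsSemiassociative F A) :
    IsSeparableAlgebra F (semisimpleQuotient A) ∧
    ∃ s : semisimpleQuotient A →ₐ[F] nucleus A,
      Function.Injective s ∧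
      (∀ x : semisimpleQuotient A, Ideal.Quotient.mk (Ring.jacobson (nucleus A)) (s x) = x) ∧
      IsCompl (Subalgebra.toSubmodule s.range)
        ((Ring.jacobson (nucleus A)).restrictScalars F) := by
  obtain ⟨-, -, K, hcomm, hK, hmin⟩ := hA
  exact mainTheorem7_general hmin
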